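/- Let $\mathcal S^n$ be the space of real symmetric $n\times n$ matrices with the Frobenius norm $\|\cdot\|$, and let $\Pi_{\mathcal S^n_+}$ be the metric projection onto the cone $\mathcal S^n_+$ of positive semidefinite matrices. For $A\in\mathcal S^n$ let $\lambda_1(A)\ge\dots\ge\lambda_n(A)$ be its eigenvalues, counted with multiplicity, and let $v_1(A)>\dots>v_d(A)$ be the distinct ones. Write $\pi(A)=\pi(B)$ if $A$ and $B$ have the same eigenvalue index partition, the eigenvalue zero being marked: for all $i,j$, $\lambda_i(A)=\lambda_j(A)\iff\lambda_i(B)=\lambda_j(B)$, and for all $i$, $\lambda_i(A)=0\iff\lambda_i(B)=0$. Let $\bar A\in\mathcal S^n$, and let $r>0$ satisfy $r<\min_{i<j}\{v_i(\bar A)-v_j(\bar A)\}/3$ and $r<|v_i(\bar A)|$ for every nonzero eigenvalue $v_i(\bar A)$ (the second condition follows from the first if $\bar A$ is singular; a minimum over the empty set is $+\infty$). Then $\Pi_{\mathcal S^n_+}$ is uniformly first-order B-differentiable at the matrices $A$ with $\|A-\bar A\|\le r$ and $\pi(A)=\pi(\bar A)$. That is, there are constants $\delta>0$ and $l>0$ such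 that for every such $A\in\mathcal S^n$ the directional derivative $\Pi'_{\mathcal S^n_+}(A;H)=\lim_{t\downarrow0}t^{-1}\bigl(\Pi_{\mathcal S^n_+}(A+tH)-\Pi_{\mathcal S^n_+}(A)\bigr)$ exists for all $H\in\mathcal S^n$, and $$\bigl\|\Pi_{\mathcal S^n_+}(A+H)-\Pi_{\mathcal S^n_+}(A)-\Pi'_{\mathcal S^n_+}(A;H)\bigr\|\le l\,\|H\|^2\qquad\text{for all }H\in\mathcal S^n\text{ with }\|H\|\le\delta .$$ -/

import Mathlib

open Filter Topology

-- Matrices carry the Frobenius norm throughout.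
attribute [local instance] Matrix.frobeniusNormedAddCommGroup Matrix.frobeniusNormedSpace

/-- The cone of real positive semidefinite (in particular symmetric) `n × n` matrices. -/
def psdCone (n : ℕ) : Set (Matrix (Fin n) (Fin n) ℝ) := {X | X.PosSemidef}

theorem psdCone_isClosed (n : ℕ) : IsClosed (psdCone n) := by
  have h : psdCone n = {X : Matrix (Fin n) (Fin n) ℝ | X.conjTranspose = X} ∩
      ⋂ x : Fin n → ℝ, {X : Matrix (Fin n) (Fin n) ℝ | 0 ≤ star x ⬝ᵥ (X.mulVec x)} := by
    ext X
    simp only [psdCone, Set.mem_ofPred_eq, Set.mem_inter_iff, Set.mem_iInter,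
      Matrix.posSemidef_iff_dotProduct_mulVec, Matrix.IsHermitian]
  rw [h]
  refine IsClosed.inter ?_ (isClosed_iInter fun x => ?_)
  · exact isClosed_eq (by fun_prop) continuous_id
  · exact isClosed_le continuous_const
      (continuous_const.dotProduct (continuous_id.matrix_mulVec continuous_const))

/-- `X` is a nearest point to `A`, in the Frobenius norm, in the positive semidefinite cone. -/
def IsPsdProj {n : ℕ} (A X : Matrix (Fin n) (Fin n) ℝ) : Prop :=
  X ∈ psdCone n ∧ ∀ Y ∈ psdCone n, ‖A - X‖ ≤ ‖A - Y‖

theorem exists_isPsdProj {n : ℕ} (A : Matrix (Fin n) (Fin n) ℝ) : ∃ X, IsPsdProj A X := by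
  have : ProperSpace (Matrix (Fin n) (Fin n) ℝ) := FiniteDimensional.proper_real _
  have hne : (psdCone n).Nonempty := ⟨0, Matrix.PosSemidef.zero⟩
  obtain ⟨X, hX, hd⟩ := (psdCone_isClosed n).exists_infDist_eq_dist hne A
  refine ⟨X, hX, fun Y hY => ?_⟩
  rw [← dist_eq_norm, ← dist_eq_norm, ← hd]
  exact Metric.infDist_le_dist_of_mem hY

/-- The metric projection onto the positive semidefinite cone: the nearest positive semidefinite
matrix in the Frobenius norm (it is unique, as the cone is convex). -/
noncomputable def psdProj {n : ℕ} (A : Matrix (Fin n) (Fin n) ℝ) : Matrix (Fin n) (Fin n) ℝ :=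
  Classical.choose (exists_isPsdProj A)

theorem psdProj_spec {n : ℕ} (A : Matrix (Fin n) (Fin n) ℝ) : IsPsdProj A (psdProj A) :=
  Classical.choose_spec (exists_isPsdProj A)

/-- `D` is the (one-sided) directional derivative of `F` at `A` along `H`. -/
def HasDirDerivAt {E G : Type*} [NormedAddCommGroup E] [NormedSpace ℝ E]
    [NormedAddCommGroup G] [NormedSpace ℝ G] (F : E → G) (A H : E) (D : G) : Prop :=
  Tendsto (fun t : ℝ => t⁻¹ • (F (A + t • H) - F A)) (𝓝[>] 0) (𝓝 D)

/-- `A` and `B` have the same eigenvalue index partition. With the eigenvalues listed in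
nonincreasing order, counted with multiplicity (this is `eigenvalues₀`), the sets of indices
belonging to one eigenvalue are the same for `A` and `B`, and so is the (possibly empty) set of
indices belonging to the eigenvalue `0`. -/
def SameEigenIndexPartition {n : ℕ} {A B : Matrix (Fin n) (Fin n) ℝ}
    (hA : A.IsHermitian) (hB : B.IsHermitian) : Prop :=
  (∀ i j, hA.eigenvalues₀ i = hA.eigenvalues₀ j ↔ hB.eigenvalues₀ i = hB.eigenvalues₀ j) ∧
    ∀ i, hA.eigenvalues₀ i = 0 ↔ hB.eigenvalues₀ i = 0

/-! The projection of `B` is `X` exactly when `B = X - Y` with `X`, `Y` positive semidefinite and `X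
* Y = 0` (Moreau), and `X` depends on `B` in a nonexpansive way. So it suffices to find a Moreau
pair whose difference is within `O(‖H‖ ^ 2)` of `A + H`; its first component then approximates the
projection of `A + H` to the same order.

Diagonalise `A` and split the coordinates into blocks by the sign of the eigenvalue. A skew `K` with
`[K, A]` equal to the off-block part of `H` absorbs that part. The diagonal blocks of `A + H` give a
complementary pair `P`, `Q`: the positive block stays positive, the negative one negative, and the
zero block of `H` is itself Moreau-decomposed. The pair `(1 + K) P (1 + K)ᵀ`, `W Q Wᵀ` with `W = (1
- K)⁻¹` is exactly complementary, because `(1 + K)ᵀ = 1 - K`, and its difference is `A + H` up to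
second order (`norm_psdProj_sub_rotation_le`, `norm_psdProj_diagonal_add_sub_le`).

The constants depend only on a bound `R` for `‖A‖` and a lower bound `c` for the nonzero `|λ_i(A)|`.
Weyl's inequality (`eigenvalues₀_sub_le`) and the common index set of the eigenvalue zero make `c`
uniform. The model is positively homogeneous in `H`, hence is the directional derivative. -/

/-! ### Frobenius norm and quadratic forms. -/

theorem Matrix.frobenius_norm_sq {m n : Type*} [Fintype m] [Fintype n] (A : Matrix m n ℝ) :
    ‖A‖ ^ 2 = ∑ i, ∑ j, A i j ^ 2 := by
  rw [Matrix.frobenius_norm_def, ← Real.sqrt_eq_rpow, Real.sq_sqrt (by positivity)]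
  simp

theorem Matrix.frobenius_norm_sq_eq_trace {m n : Type*} [Fintype m] [Fintype n]
    (A : Matrix m n ℝ) : ‖A‖ ^ 2 = (A.transpose * A).trace := by
  rw [Matrix.frobenius_norm_sq, Finset.sum_comm]
  simp [Matrix.trace, Matrix.mul_apply, sq]

theorem Matrix.frobenius_norm_le_mul_of_forall_abs_le {m n : Type*} [Fintype m] [Fintype n]
    {A B : Matrix m n ℝ} {a : ℝ} (ha : 0 ≤ a) (h : ∀ i j, |A i j| ≤ a * |B i j|) :
    ‖A‖ ≤ a * ‖B‖ := by
  refine le_of_sq_le_sq ?_ (by positivity)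
  rw [mul_pow, Matrix.frobenius_norm_sq, Matrix.frobenius_norm_sq, Finset.mul_sum]
  refine Finset.sum_le_sum fun i _ => ?_
  rw [Finset.mul_sum]
  refine Finset.sum_le_sum fun j _ => ?_
  rw [← mul_pow, sq_le_sq, abs_mul, abs_of_nonneg ha]
  exact h i j

/-- The quadratic form of a matrix is bounded by its Frobenius norm. -/
theorem Matrix.abs_dotProduct_mulVec_le {n : Type*} [Fintype n] (A : Matrix n n ℝ) (x : n → ℝ) :
    |x ⬝ᵥ A.mulVec x| ≤ ‖A‖ * (x ⬝ᵥ x) := by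
  have hx : 0 ≤ x ⬝ᵥ x := by simpa using dotProduct_star_self_nonneg x
  refine abs_le_of_sq_le_sq ?_ (by positivity)
  have h1 : x ⬝ᵥ A.mulVec x = ∑ p : n × n, A p.1 p.2 * (x p.1 * x p.2) := by
    rw [Fintype.sum_prod_type]
    simp only [dotProduct, Matrix.mulVec, Finset.mul_sum]
    exact Finset.sum_congr rfl fun i _ => Finset.sum_congr rfl fun j _ => by ring
  have h2 : (x ⬝ᵥ x) ^ 2 = ∑ p : n × n, (x p.1 * x p.2) ^ 2 := by
    rw [Fintype.sum_prod_type, sq, dotProduct, Finset.sum_mul_sum]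
    exact Finset.sum_congr rfl fun i _ => Finset.sum_congr rfl fun j _ => by ring
  rw [mul_pow, Matrix.frobenius_norm_sq, h2, h1, ← Fintype.sum_prod_type' (fun i j => A i j ^ 2)]
  exact Finset.sum_mul_sq_le_sq_mul_sq _ _ _

theorem Matrix.IsHermitian.posSemidef_smul_one_add {n : Type*} [Fintype n] [DecidableEq n]
    {H : Matrix n n ℝ} (hH : H.IsHermitian) {c : ℝ} (hc : ‖H‖ ≤ c) :
    (c • (1 : Matrix n n ℝ) + H).PosSemidef := by
  refine Matrix.PosSemidef.of_dotProduct_mulVec_nonneg ?_ fun x => ?_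
  · exact Matrix.IsHermitian.add (by simp [Matrix.IsHermitian]) hH
  · have h1 := Matrix.abs_dotProduct_mulVec_le H x
    have hx : 0 ≤ x ⬝ᵥ x := by simpa using dotProduct_star_self_nonneg x
    have h2 := neg_le_of_abs_le h1
    have h3 := mul_le_mul_of_nonneg_right hc hx
    simp only [star_trivial, Matrix.add_mulVec, Matrix.smul_mulVec, Matrix.one_mulVec,
      dotProduct_add, dotProduct_smul, smul_eq_mul]
    linarith

/-! ### Moreau decomposition and the projection onto the cone. -/

/-- Self-polarity of the cone: with `X = Cᵀ C` the trace becomes that of `C Y Cᵀ`. -/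
theorem Matrix.PosSemidef.trace_mul_nonneg {n : Type*} [Fintype n]
    {X Y : Matrix n n ℝ} (hX : X.PosSemidef) (hY : Y.PosSemidef) : 0 ≤ (X * Y).trace := by
  classical
  obtain ⟨C, rfl⟩ : ∃ C : Matrix n n ℝ, X = C.conjTranspose * C := by
    open scoped MatrixOrder in
    exact CStarAlgebra.nonneg_iff_eq_star_mul_self.mp hX.nonneg
  rw [Matrix.mul_assoc, Matrix.trace_mul_comm]
  exact (hY.mul_mul_conjTranspose_same C).trace_nonneg

/-- A Moreau decomposition depends on the decomposed matrix in a nonexpansive way. -/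
theorem Matrix.PosSemidef.norm_sub_le_of_mul_eq_zero {n : Type*} [Fintype n]
    {X Y X' Y' : Matrix n n ℝ} (hX : X.PosSemidef) (hY : Y.PosSemidef) (hXY : X * Y = 0)
    (hX' : X'.PosSemidef) (hY' : Y'.PosSemidef) (hXY' : X' * Y' = 0) :
    ‖X - X'‖ ≤ ‖(X - Y) - (X' - Y')‖ := by
  refine le_of_sq_le_sq ?_ (norm_nonneg _)
  have e : (X - Y) - (X' - Y') = (X - X') - (Y - Y') := by abel
  have t : ∀ {Z : Matrix n n ℝ}, Z.PosSemidef → Z.transpose = Z := fun h => by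
    simpa [Matrix.IsHermitian, Matrix.conjTranspose_eq_transpose_of_trivial] using h.1
  have h1 := hX.trace_mul_nonneg hY'
  have h2 := hX'.trace_mul_nonneg hY
  have h3 := sq_nonneg ‖Y - Y'‖
  have h4 : (Y * X).trace = 0 := by rw [Matrix.trace_mul_comm, hXY, Matrix.trace_zero]
  have h5 : (Y' * X').trace = 0 := by rw [Matrix.trace_mul_comm, hXY', Matrix.trace_zero]
  have h6 := Matrix.trace_mul_comm Y X'
  have h7 := Matrix.trace_mul_comm Y' X
  -- With `⟨X, Y⟩ = ⟨X', Y'⟩ = 0`, the cross term `-2⟨X - X', Y - Y'⟩` equals `2⟨X, Y'⟩ + 2⟨X', Y⟩ ≥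
  -- 0`.
  rw [e]
  rw [Matrix.frobenius_norm_sq_eq_trace] at h3 ⊢
  rw [Matrix.frobenius_norm_sq_eq_trace]
  simp only [Matrix.transpose_sub, t hX, t hX', t hY, t hY', Matrix.sub_mul, Matrix.mul_sub,
    Matrix.trace_sub, hXY, hXY', Matrix.trace_zero, h4, h5] at h3 ⊢
  linarith

/-- Comparing the minimiser `Z` with the competitor `X` gives `‖Z - X‖² + 2⟨Z, Y⟩ + ‖Y‖² ≤ ‖Y‖²`,
and `⟨Z, Y⟩ ≥ 0`. This also shows that the choice made in `psdProj` is immaterial. -/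
theorem psdProj_sub_of_mul_eq_zero {n : ℕ} {X Y : Matrix (Fin n) (Fin n) ℝ}
    (hX : X.PosSemidef) (hY : Y.PosSemidef) (hXY : X * Y = 0) : psdProj (X - Y) = X := by
  obtain ⟨hZ, hmin⟩ := psdProj_spec (X - Y)
  generalize psdProj (X - Y) = Z at hZ hmin
  have hZ : Z.PosSemidef := hZ
  have h := hmin X hX
  have h0 : X - Y - X = -Y := by abel
  have t : ∀ {Z : Matrix (Fin n) (Fin n) ℝ}, Z.PosSemidef → Z.transpose = Z := fun h => by
    simpa [Matrix.IsHermitian, Matrix.conjTranspose_eq_transpose_of_trivial] using h.1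
  have h1 := hZ.trace_mul_nonneg hY
  have h4 : (Y * X).trace = 0 := by rw [Matrix.trace_mul_comm, hXY, Matrix.trace_zero]
  have h6 := Matrix.trace_mul_comm Y Z
  rw [h0, norm_neg] at h
  have h := pow_le_pow_left₀ (norm_nonneg _) h 2
  have h3 : ‖Z - X‖ ^ 2 ≤ 0 := by
    rw [Matrix.frobenius_norm_sq_eq_trace] at h ⊢
    rw [Matrix.frobenius_norm_sq_eq_trace] at h
    simp only [Matrix.transpose_sub, t hX, t hY, t hZ, Matrix.sub_mul, Matrix.mul_sub,
      Matrix.trace_sub, hXY, Matrix.trace_zero, h4] at h ⊢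
    linarith
  have h3 : ‖Z - X‖ = 0 := by
    have := sq_nonneg ‖Z - X‖
    exact pow_eq_zero_iff two_ne_zero |>.1 (le_antisymm h3 this)
  exact sub_eq_zero.1 (norm_eq_zero.1 h3)

theorem Matrix.IsHermitian.exists_eq_mul_diagonal_mul_transpose {n : Type*} [Fintype n]
    [DecidableEq n] {A : Matrix n n ℝ} (hA : A.IsHermitian) :
    ∃ U : Matrix n n ℝ, U.transpose * U = 1 ∧ U * U.transpose = 1 ∧
      A = U * Matrix.diagonal hA.eigenvalues * U.transpose := by
  refine ⟨hA.eigenvectorUnitary, ?_, ?_, ?_⟩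
  · exact Unitary.coe_star_mul_self hA.eigenvectorUnitary
  · exact Unitary.coe_mul_star_self hA.eigenvectorUnitary
  · exact hA.spectral_theorem

/-- Every symmetric matrix is the difference of two complementary positive semidefinite ones. -/
theorem Matrix.IsHermitian.exists_posSemidef_sub {n : Type*} [Fintype n]
    {A : Matrix n n ℝ} (hA : A.IsHermitian) :
    ∃ X Y : Matrix n n ℝ, X.PosSemidef ∧ Y.PosSemidef ∧ X * Y = 0 ∧ A = X - Y := by
  classical
  obtain ⟨U, hU, -, h⟩ := hA.exists_eq_mul_diagonal_mul_transpose
  refine ⟨U * Matrix.diagonal (fun i => (hA.eigenvalues i)⁺) * U.transpose,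
    U * Matrix.diagonal (fun i => (hA.eigenvalues i)⁻) * U.transpose, ?_, ?_, ?_, ?_⟩
  · exact (Matrix.PosSemidef.diagonal fun i => posPart_nonneg _).mul_mul_conjTranspose_same U
  · exact (Matrix.PosSemidef.diagonal fun i => negPart_nonneg _).mul_mul_conjTranspose_same U
  · calc _ = U * Matrix.diagonal (fun i => (hA.eigenvalues i)⁺) * (U.transpose * U) *
          Matrix.diagonal (fun i => (hA.eigenvalues i)⁻) * U.transpose := by
            simp only [Matrix.mul_assoc]
      _ = 0 := by
        rw [hU, Matrix.mul_one, Matrix.mul_assoc U, Matrix.diagonal_mul_diagonal]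
        have : (fun i => (hA.eigenvalues i)⁺ * (hA.eigenvalues i)⁻) = 0 := by
          ext i
          rcases le_total (hA.eigenvalues i) 0 with h | h
          · simp [posPart_eq_zero.2 h]
          · simp [negPart_eq_zero.2 h]
        rw [this]
        simp
  · rw [← Matrix.sub_mul, ← Matrix.mul_sub, Matrix.diagonal_sub]
    simpa only [posPart_sub_negPart] using h

theorem Matrix.IsHermitian.psdProj_decomposition {n : ℕ} {A : Matrix (Fin n) (Fin n) ℝ}
    (hA : A.IsHermitian) :
    (psdProj A).PosSemidef ∧ (psdProj A - A).PosSemidef ∧ psdProj A * (psdProj A - A) = 0 := by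
  obtain ⟨X, Y, hX, hY, hXY, rfl⟩ := hA.exists_posSemidef_sub
  rw [psdProj_sub_of_mul_eq_zero hX hY hXY, sub_sub_cancel]
  exact ⟨hX, hY, hXY⟩

theorem psdProj_eq_of_decomposition {n : ℕ} {A X : Matrix (Fin n) (Fin n) ℝ}
    (hX : X.PosSemidef) (hY : (X - A).PosSemidef) (hXY : X * (X - A) = 0) : psdProj A = X := by
  simpa using psdProj_sub_of_mul_eq_zero hX hY hXY

theorem Matrix.IsHermitian.norm_psdProj_sub_le {n : ℕ} {A B : Matrix (Fin n) (Fin n) ℝ}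
    (hA : A.IsHermitian) (hB : B.IsHermitian) : ‖psdProj A - psdProj B‖ ≤ ‖A - B‖ := by
  obtain ⟨h1, h2, h3⟩ := hA.psdProj_decomposition
  obtain ⟨h4, h5, h6⟩ := hB.psdProj_decomposition
  simpa using h1.norm_sub_le_of_mul_eq_zero h2 h3 h4 h5 h6

theorem psdProj_zero {n : ℕ} : psdProj (0 : Matrix (Fin n) (Fin n) ℝ) = 0 :=
  psdProj_eq_of_decomposition .zero (by simpa using .zero) (by simp)

theorem Matrix.IsHermitian.norm_psdProj_le {n : ℕ} {A : Matrix (Fin n) (Fin n) ℝ}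
    (hA : A.IsHermitian) : ‖psdProj A‖ ≤ ‖A‖ := by
  simpa [psdProj_zero] using hA.norm_psdProj_sub_le (B := 0) Matrix.isHermitian_zero

theorem Matrix.IsHermitian.psdProj_smul {n : ℕ} {A : Matrix (Fin n) (Fin n) ℝ}
    (hA : A.IsHermitian) {t : ℝ} (ht : 0 ≤ t) : psdProj (t • A) = t • psdProj A := by
  obtain ⟨h1, h2, h3⟩ := hA.psdProj_decomposition
  refine psdProj_eq_of_decomposition (h1.smul ht) ?_ ?_
  · rw [← smul_sub]
    exact h2.smul ht
  · rw [← smul_sub, Matrix.smul_mul, Matrix.mul_smul, h3, smul_zero, smul_zero]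

theorem Matrix.IsHermitian.psdProj_conj {n : ℕ} {A U : Matrix (Fin n) (Fin n) ℝ}
    (hA : A.IsHermitian) (hU : U.transpose * U = 1) :
    psdProj (U * A * U.transpose) = U * psdProj A * U.transpose := by
  obtain ⟨h1, h2, h3⟩ := hA.psdProj_decomposition
  refine psdProj_eq_of_decomposition (h1.mul_mul_conjTranspose_same U) ?_ ?_
  · rw [← Matrix.sub_mul, ← Matrix.mul_sub]
    exact h2.mul_mul_conjTranspose_same U
  · rw [← Matrix.sub_mul, ← Matrix.mul_sub]
    calc _ = U * psdProj A * (U.transpose * U) * (psdProj A - A) * U.transpose := by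
          simp only [Matrix.mul_assoc]
      _ = 0 := by rw [hU, Matrix.mul_one, Matrix.mul_assoc U, h3]; simp

theorem Matrix.frobenius_norm_conj {n : Type*} [Fintype n] [DecidableEq n] {U : Matrix n n ℝ}
    (hU : U.transpose * U = 1) (A : Matrix n n ℝ) : ‖U * A * U.transpose‖ = ‖A‖ := by
  rw [← sq_eq_sq₀ (norm_nonneg _) (norm_nonneg _), Matrix.frobenius_norm_sq_eq_trace,
    Matrix.frobenius_norm_sq_eq_trace]
  simp only [Matrix.transpose_mul, Matrix.transpose_transpose]
  calc _ = (U * A.transpose * (U.transpose * U) * A * U.transpose).trace := by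
        simp only [Matrix.mul_assoc]
    _ = _ := by
      rw [hU, Matrix.mul_one, Matrix.trace_mul_comm]
      simp only [← Matrix.mul_assoc]
      rw [hU, Matrix.one_mul]

/-! ### Rotation of Moreau pairs by a small skew matrix. -/

/-- For skew-symmetric `K`, the matrix `1 - K` is invertible. -/
theorem Matrix.exists_inverse_one_sub_of_skew {n : Type*} [Fintype n] [DecidableEq n]
    {K : Matrix n n ℝ} (hK : K.transpose = -K) :
    ∃ W : Matrix n n ℝ, (1 - K) * W = 1 ∧ W * (1 - K) = 1 := by
  have h : (1 + K.conjTranspose * K).PosDef :=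
    Matrix.PosDef.one.add_posSemidef (Matrix.posSemidef_conjTranspose_mul_self K)
  rw [Matrix.conjTranspose_eq_transpose_of_trivial, hK] at h
  -- The right side is `1 + Kᵀ K`, which is positive definite.
  have e : (1 - K) * (1 + K) = 1 + -K * K := by noncomm_ring
  rw [← e] at h
  obtain ⟨u, hu⟩ := h.isUnit
  have h1 : (1 - K) * ((1 + K) * (↑u⁻¹ : Matrix n n ℝ)) = 1 := by
    rw [← Matrix.mul_assoc, ← hu]
    exact u.mul_inv
  exact ⟨_, h1, mul_eq_one_comm.1 h1⟩

/-- Neumann expansion with exact remainder: `W = 1 + K + K² W`, and the transposed identity for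
`Wᵀ`. Powers of `‖1‖` enter because the Frobenius norm of the identity is `√n`. The constant is not
sharp. -/
theorem Matrix.norm_conj_inverse_sub_le {n : Type*} [Fintype n] [DecidableEq n]
    {K W : Matrix n n ℝ} (hK : K.transpose = -K) (hk : ‖K‖ ≤ 1 / 2)
    (hW : (1 - K) * W = 1) (M : Matrix n n ℝ) :
    ‖W * M * W.transpose - (M + (K * M - M * K))‖ ≤
      (1 + 4 * ‖(1 : Matrix n n ℝ)‖ + 8 * ‖(1 : Matrix n n ℝ)‖ ^ 2) * ‖M‖ * ‖K‖ ^ 2 := by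
  set s := ‖(1 : Matrix n n ℝ)‖ with hs
  have hW1 : W = 1 + K * W := by
    rw [← hW]
    noncomm_ring
  have hWn : ‖W‖ ≤ 2 * s := by
    have h1 : ‖W‖ ≤ s + ‖K‖ * ‖W‖ := by
      conv_lhs => rw [hW1]
      exact (norm_add_le _ _).trans (by gcongr; exact Matrix.frobenius_norm_mul _ _)
    nlinarith [norm_nonneg W]
  have hT1 : W.transpose = 1 - W.transpose * K := by
    conv_lhs => rw [hW1]
    rw [Matrix.transpose_add, Matrix.transpose_mul, hK, Matrix.transpose_one, Matrix.mul_neg]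
    abel
  have hTn : ‖W.transpose‖ ≤ 2 * s := by rwa [Matrix.frobenius_norm_transpose]
  have hs0 : 0 ≤ s := norm_nonneg _
  have e1 : W = 1 + K + K * K * W := by
    conv_lhs => rw [hW1, hW1]
    noncomm_ring
  have e2 : W.transpose = 1 - K + W.transpose * K * K := by
    conv_lhs => rw [hT1, hT1]
    noncomm_ring
  have e : W * M * W.transpose - (M + (K * M - M * K)) =
      -(K * M * K) + K * K * W * M * W.transpose + (1 + K) * M * (W.transpose * K * K) := by
    have e3 : W * M * W.transpose =
        (1 + K) * M * W.transpose + K * K * W * M * W.transpose := by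
      rw [← Matrix.add_mul, ← Matrix.add_mul, ← e1]
    have e4 : (1 + K) * M * W.transpose =
        (1 + K) * M * (1 - K) + (1 + K) * M * (W.transpose * K * K) := by
      rw [← Matrix.mul_add, ← e2]
    rw [e3, e4]
    noncomm_ring
  have mul_le : ∀ {A B : Matrix n n ℝ} {a b : ℝ}, 0 ≤ a → ‖A‖ ≤ a → ‖B‖ ≤ b →
      ‖A * B‖ ≤ a * b := fun ha hA hB =>
    (Matrix.frobenius_norm_mul _ _).trans (mul_le_mul hA hB (norm_nonneg _) ha)
  have hm := norm_nonneg M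
  have hk0 := norm_nonneg K
  have b1 : ‖K * M * K‖ ≤ ‖K‖ * ‖M‖ * ‖K‖ :=
    mul_le (by positivity) (mul_le hk0 le_rfl le_rfl) le_rfl
  have b2 : ‖K * K * W * M * W.transpose‖ ≤ ‖K‖ * ‖K‖ * (2 * s) * ‖M‖ * (2 * s) :=
    mul_le (by positivity) (mul_le (by positivity) (mul_le (by positivity)
      (mul_le hk0 le_rfl le_rfl) hWn) le_rfl) hTn
  have b3 : ‖(1 + K) * M * (W.transpose * K * K)‖ ≤ (s + 1 / 2) * ‖M‖ * (2 * s * ‖K‖ * ‖K‖) :=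
    mul_le (by positivity) (mul_le (by positivity)
      ((norm_add_le _ _).trans (by gcongr)) le_rfl)
      (mul_le (by positivity) (mul_le (by positivity) hTn le_rfl) le_rfl)
  rw [e]
  refine (norm_add₃_le).trans ?_
  rw [norm_neg]
  have h3 : 0 ≤ s * (‖M‖ * ‖K‖ ^ 2) := by positivity
  have h4 : 0 ≤ s ^ 2 * (‖M‖ * ‖K‖ ^ 2) := by positivity
  nlinarith [b1, b2, b3]

/-- Rotating complementary positive semidefinite matrices by a small skew-symmetric `K` gives, up
to second order in `K`, the projection of the rotated difference. -/
theorem norm_psdProj_sub_rotation_le {n : ℕ} {B K P Q : Matrix (Fin n) (Fin n) ℝ}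
    (hB : B.IsHermitian) (hK : K.transpose = -K) (hk : ‖K‖ ≤ 1 / 2)
    (hP : P.PosSemidef) (hQ : Q.PosSemidef) (hPQ : P * Q = 0) :
    ‖psdProj B - (P + (K * P - P * K))‖ ≤
      ‖B - ((P - Q) + (K * (P - Q) - (P - Q) * K))‖ + (2 * ‖P‖ +
        (1 + 4 * ‖(1 : Matrix (Fin n) (Fin n) ℝ)‖ + 8 * ‖(1 : Matrix (Fin n) (Fin n) ℝ)‖ ^ 2) *
          ‖Q‖) * ‖K‖ ^ 2 := by
  obtain ⟨W, hW, hW'⟩ := Matrix.exists_inverse_one_sub_of_skew hK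
  have hQW := Matrix.norm_conj_inverse_sub_le hK hk hW Q
  set C := 1 + 4 * ‖(1 : Matrix (Fin n) (Fin n) ℝ)‖ + 8 * ‖(1 : Matrix (Fin n) (Fin n) ℝ)‖ ^ 2
  have hKt : (1 + K).transpose = 1 - K := by
    rw [Matrix.transpose_add, hK, Matrix.transpose_one, sub_eq_add_neg]
  have hX : ((1 + K) * P * (1 - K)).PosSemidef := by
    rw [← hKt]
    exact hP.mul_mul_conjTranspose_same _
  have hY : (W * Q * W.transpose).PosSemidef := hQ.mul_mul_conjTranspose_same W
  -- The factor `1 - K` meets its inverse `W`, so complementarity survives exactly and not merely to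
  -- first order.
  have hXY : ((1 + K) * P * (1 - K)) * (W * Q * W.transpose) = 0 := by
    calc _ = (1 + K) * P * ((1 - K) * W) * Q * W.transpose := by simp only [Matrix.mul_assoc]
      _ = 0 := by
        rw [hW, Matrix.mul_one, Matrix.mul_assoc (1 + K), hPQ]
        simp
  have h1 := hB.norm_psdProj_sub_le (hX.1.sub hY.1)
  rw [psdProj_sub_of_mul_eq_zero hX hY hXY] at h1
  have hKPK : ‖K * P * K‖ ≤ ‖P‖ * ‖K‖ ^ 2 := by
    refine (Matrix.frobenius_norm_mul _ _).trans ?_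
    have := mul_le_mul_of_nonneg_right (Matrix.frobenius_norm_mul K P) (norm_nonneg K)
    linarith
  have eX : (1 + K) * P * (1 - K) = P + (K * P - P * K) - K * P * K := by noncomm_ring
  have e1 : psdProj B - (P + (K * P - P * K)) =
      (psdProj B - (1 + K) * P * (1 - K)) - K * P * K := by rw [eX]; abel
  have e2 : B - ((1 + K) * P * (1 - K) - W * Q * W.transpose) =
      (B - ((P - Q) + (K * (P - Q) - (P - Q) * K))) + K * P * K +
        (W * Q * W.transpose - (Q + (K * Q - Q * K))) := by rw [eX]; noncomm_ring
  rw [e2] at h1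
  have h2 := h1.trans norm_add₃_le
  -- The term `K P K` is paid for twice, in `e1` and in `e2`, hence `2 * ‖P‖`.
  rw [e1]
  have h3 := norm_sub_le (psdProj B - (1 + K) * P * (1 - K)) (K * P * K)
  linarith

/-- The projection `X` of `G` satisfies `X² = X G`, so `(X P)ᵀ (X P) = Pᵀ X G P = 0`. It keeps the
projection of the zero block inside that block. -/
theorem Matrix.IsHermitian.psdProj_mul_eq_zero {n : ℕ} {G P : Matrix (Fin n) (Fin n) ℝ}
    (hG : G.IsHermitian) (h : G * P = 0) : psdProj G * P = 0 := by
  obtain ⟨hX, -, hXY⟩ := hG.psdProj_decomposition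
  rw [Matrix.mul_sub, sub_eq_zero] at hXY
  rw [← Matrix.conjTranspose_mul_self_eq_zero, Matrix.conjTranspose_mul, hX.1.eq]
  calc _ = P.conjTranspose * (psdProj G * psdProj G) * P := by simp only [Matrix.mul_assoc]
    _ = 0 := by
      rw [hXY, Matrix.mul_assoc, Matrix.mul_assoc, h]
      simp

/-! ### Sign blocks and the expansion at a diagonal matrix. -/

/-- The diagonal projection onto the coordinates where `d` has sign `σ`. -/
noncomputable def signProj {n : ℕ} (d : Fin n → ℝ) (σ : SignType) : Matrix (Fin n) (Fin n) ℝ :=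
  Matrix.diagonal fun i => if SignType.sign (d i) = σ then 1 else 0

/-- The diagonal block of `H` belonging to the coordinates where `d` has sign `σ`. -/
noncomputable def signBlock {n : ℕ} (d : Fin n → ℝ) (σ : SignType) (H : Matrix (Fin n) (Fin n) ℝ) :
    Matrix (Fin n) (Fin n) ℝ :=
  signProj d σ * H * signProj d σ

/-- The skew-symmetric solution `K` of `K * Λ - Λ * K = H` off the sign blocks, where
`Λ = diagonal d`. -/
noncomputable def signRotation {n : ℕ} (d : Fin n → ℝ) (H : Matrix (Fin n) (Fin n) ℝ) :
    Matrix (Fin n) (Fin n) ℝ :=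
  Matrix.of fun i j =>
    if SignType.sign (d i) = SignType.sign (d j) then 0 else H i j / (d j - d i)

/-- The directional derivative of the projection at the diagonal matrix with entries `d`. -/
noncomputable def diagonalDeriv {n : ℕ} (d : Fin n → ℝ) (H : Matrix (Fin n) (Fin n) ℝ) :
    Matrix (Fin n) (Fin n) ℝ :=
  signBlock d 1 H + psdProj (signBlock d 0 H) +
    (signRotation d H * signBlock d 1 (Matrix.diagonal d) -
      signBlock d 1 (Matrix.diagonal d) * signRotation d H)

section SignBlocks

variable {n : ℕ} (d : Fin n → ℝ) (H : Matrix (Fin n) (Fin n) ℝ)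

theorem signProj_mul_signProj_of_ne {σ τ : SignType} (h : σ ≠ τ) :
    signProj d σ * signProj d τ = 0 := by
  rw [signProj, signProj, Matrix.diagonal_mul_diagonal, Matrix.diagonal_eq_zero]
  ext i
  by_cases h1 : SignType.sign (d i) = σ
  · simp [h1, h]
  · simp [h1]

theorem signProj_transpose (σ : SignType) : (signProj d σ).transpose = signProj d σ :=
  Matrix.diagonal_transpose _

theorem signBlock_apply (σ : SignType) (i j : Fin n) : signBlock d σ H i j =
    if SignType.sign (d i) = σ ∧ SignType.sign (d j) = σ then H i j else 0 := by
  rw [signBlock, signProj, Matrix.mul_diagonal, Matrix.diagonal_mul]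
  by_cases h1 : SignType.sign (d i) = σ <;> by_cases h2 : SignType.sign (d j) = σ <;> simp [h1, h2]

theorem signBlock_add (σ : SignType) (G H : Matrix (Fin n) (Fin n) ℝ) :
    signBlock d σ (G + H) = signBlock d σ G + signBlock d σ H := by
  simp only [signBlock, Matrix.mul_add, Matrix.add_mul]

theorem signBlock_neg (σ : SignType) (H : Matrix (Fin n) (Fin n) ℝ) :
    signBlock d σ (-H) = -signBlock d σ H := by
  simp only [signBlock, Matrix.mul_neg, Matrix.neg_mul]

theorem signBlock_smul (σ : SignType) (t : ℝ) (H : Matrix (Fin n) (Fin n) ℝ) :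
    signBlock d σ (t • H) = t • signBlock d σ H := by
  simp only [signBlock, Matrix.mul_smul, Matrix.smul_mul]

theorem signRotation_smul (t : ℝ) : signRotation d (t • H) = t • signRotation d H := by
  ext i j
  simp only [signRotation, Matrix.of_apply, Matrix.smul_apply, smul_eq_mul]
  split_ifs <;> ring

theorem norm_signBlock_le (σ : SignType) : ‖signBlock d σ H‖ ≤ ‖H‖ := by
  rw [← one_mul ‖H‖]
  refine Matrix.frobenius_norm_le_mul_of_forall_abs_le zero_le_one fun i j => ?_
  rw [signBlock_apply]
  split_ifs <;> simp

theorem norm_signBlocks_le :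
    ‖signBlock d 1 H + signBlock d (-1) H + signBlock d 0 H‖ ≤ ‖H‖ := by
  rw [← one_mul ‖H‖]
  refine Matrix.frobenius_norm_le_mul_of_forall_abs_le zero_le_one fun i j => ?_
  simp only [Matrix.add_apply, signBlock_apply]
  rcases SignType.sign (d i) <;> rcases SignType.sign (d j) <;> simp

theorem signBlocks_diagonal : signBlock d 1 (Matrix.diagonal d) +
    signBlock d (-1) (Matrix.diagonal d) = Matrix.diagonal d := by
  ext i j
  simp only [Matrix.add_apply, signBlock_apply, Matrix.diagonal_apply]
  by_cases hij : i = j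
  · subst hij
    rcases lt_trichotomy (d i) 0 with h | h | h
    · simp [h]
    · simp [h]
    · simp [h]
  · simp [hij]

theorem signRotation_commutator :
    signRotation d H * Matrix.diagonal d - Matrix.diagonal d * signRotation d H =
      H - (signBlock d 1 H + signBlock d (-1) H + signBlock d 0 H) := by
  ext i j
  simp only [Matrix.sub_apply, Matrix.add_apply, signBlock_apply, Matrix.mul_diagonal,
    Matrix.diagonal_mul, signRotation, Matrix.of_apply]
  by_cases h : SignType.sign (d i) = SignType.sign (d j)
  · rcases hs : SignType.sign (d j) <;> simp [h, hs]
  · have h1 : d j - d i ≠ 0 := fun h2 => h (by rw [sub_eq_zero.1 h2])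
    have h2 : ∀ σ, ¬(SignType.sign (d i) = σ ∧ SignType.sign (d j) = σ) :=
      fun σ hσ => h (hσ.1.trans hσ.2.symm)
    simp only [h, h2, if_false]
    field_simp
    ring

variable {d H}

theorem signBlock_isHermitian (hH : H.IsHermitian) (σ : SignType) :
    (signBlock d σ H).IsHermitian := by
  have := Matrix.isHermitian_mul_mul_conjTranspose (signProj d σ) hH
  rwa [Matrix.conjTranspose_eq_transpose_of_trivial, signProj_transpose] at this

theorem signRotation_transpose (hH : H.IsHermitian) :
    (signRotation d H).transpose = -signRotation d H := by
  ext i j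
  have h : H j i = H i j := by simpa using hH.apply i j
  simp only [signRotation, Matrix.transpose_apply, Matrix.neg_apply, Matrix.of_apply, h,
    eq_comm (a := SignType.sign (d j))]
  split_ifs
  · simp
  · rw [← div_neg, neg_sub]

/-- Entries with different signs are at least `c` apart: one of them is nonzero, of modulus at least
`c`, and the other is zero or lies on the opposite side of zero. -/
theorem norm_signRotation_le {c : ℝ} (hc : 0 < c) (hd : ∀ i, d i = 0 ∨ c ≤ |d i|) :
    ‖signRotation d H‖ ≤ c⁻¹ * ‖H‖ := by
  refine Matrix.frobenius_norm_le_mul_of_forall_abs_le (inv_nonneg.2 hc.le) fun i j => ?_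
  simp only [signRotation, Matrix.of_apply]
  split_ifs with h
  · simpa using mul_nonneg (inv_nonneg.2 hc.le) (abs_nonneg _)
  · rw [abs_div, div_eq_inv_mul]
    refine mul_le_mul_of_nonneg_right (inv_anti₀ hc ?_) (abs_nonneg _)
    rw [le_abs]
    have key : ∀ i, (d i = 0) ∨ (0 < d i ∧ c ≤ d i) ∨ (d i < 0 ∧ c ≤ -d i) := by
      intro i
      rcases lt_trichotomy (d i) 0 with h | h | h
      · exact .inr (.inr ⟨h, by simpa [h.ne, abs_of_neg h] using hd i⟩)
      · exact .inl h
      · exact .inr (.inl ⟨h, by simpa [h.ne', abs_of_pos h] using hd i⟩)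
    rcases key i with hi | ⟨hi, hi'⟩ | ⟨hi, hi'⟩ <;> rcases key j with hj | ⟨hj, hj'⟩ | ⟨hj, hj'⟩
    · exact absurd (by rw [hi, hj]) h
    · left; linarith
    · right; linarith
    · right; linarith
    · exact absurd (by rw [sign_pos hi, sign_pos hj]) h
    · right; linarith
    · left; linarith
    · left; linarith
    · exact absurd (by rw [sign_neg hi, sign_neg hj]) h

/-- On the positive coordinates, `Λ + H = (c • 1 + H) + (Λ - c • 1)` with both summands positive
semidefinite. -/
theorem signBlock_one_posSemidef {c : ℝ} (hd : ∀ i, d i = 0 ∨ c ≤ |d i|)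
    (hH : H.IsHermitian) (hHc : ‖H‖ ≤ c) : (signBlock d 1 (Matrix.diagonal d + H)).PosSemidef := by
  have h1 := (hH.posSemidef_smul_one_add hHc).mul_mul_conjTranspose_same (signProj d 1)
  rw [Matrix.conjTranspose_eq_transpose_of_trivial, signProj_transpose] at h1
  have h2 : (Matrix.diagonal fun i => if 0 < d i then d i - c else 0).PosSemidef := by
    refine Matrix.PosSemidef.diagonal fun i => ?_
    simp only [Pi.zero_apply]
    split_ifs with h
    · have : c ≤ d i := by simpa [h.ne', abs_of_pos h] using hd i
      linarith
    · exact le_rfl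
  convert h1.add h2 using 1
  change _ = signBlock d 1 _ + _
  rw [signBlock_add, signBlock_add, add_right_comm]
  congr 1
  ext i j
  simp only [Matrix.add_apply, signBlock_apply, Matrix.diagonal_apply, Matrix.smul_apply,
    Matrix.one_apply, smul_eq_mul, sign_eq_one_iff]
  by_cases hij : i = j
  · subst hij
    by_cases h : 0 < d i <;> simp [h]
  · simp [hij]

theorem signBlock_neg_one_posSemidef {c : ℝ} (hd : ∀ i, d i = 0 ∨ c ≤ |d i|)
    (hH : H.IsHermitian) (hHc : ‖H‖ ≤ c) :
    (-signBlock d (-1) (Matrix.diagonal d + H)).PosSemidef := by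
  have h := signBlock_one_posSemidef (d := -d) (H := -H) (c := c) (by simpa using hd) hH.neg
    (by rwa [norm_neg])
  have e : signProj (-d) 1 = signProj d (-1) := by
    simp only [signProj, Pi.neg_apply, sign_eq_one_iff, Left.neg_pos_iff, sign_eq_neg_one_iff]
  rw [← signBlock_neg]
  convert h using 1
  rw [signBlock, signBlock, e, neg_add, Matrix.diagonal_neg]
  rfl

theorem psdProj_diagonal {c : ℝ} (hc : 0 ≤ c) (hd : ∀ i, d i = 0 ∨ c ≤ |d i|) :
    psdProj (Matrix.diagonal d) = signBlock d 1 (Matrix.diagonal d) := by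
  have h1 := signBlock_one_posSemidef hd Matrix.isHermitian_zero (by simpa using hc)
  have h2 := signBlock_neg_one_posSemidef hd Matrix.isHermitian_zero (by simpa using hc)
  rw [add_zero] at h1 h2
  have h3 := psdProj_sub_of_mul_eq_zero h1 h2 ?_
  · rwa [sub_neg_eq_add, signBlocks_diagonal] at h3
  · rw [Matrix.mul_neg, neg_eq_zero, signBlock, signBlock]
    calc _ = signProj d 1 * Matrix.diagonal d * (signProj d 1 * signProj d (-1)) *
          Matrix.diagonal d * signProj d (-1) := by simp only [Matrix.mul_assoc]
      _ = 0 := by rw [signProj_mul_signProj_of_ne d (by decide)]; simp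

theorem diagonalDeriv_smul (hH : H.IsHermitian) {t : ℝ} (ht : 0 ≤ t) :
    diagonalDeriv d (t • H) = t • diagonalDeriv d H := by
  simp only [diagonalDeriv, signBlock_smul, signRotation_smul,
    (signBlock_isHermitian hH 0).psdProj_smul ht, Matrix.smul_mul, Matrix.mul_smul, smul_add,
    smul_sub]

/-- The blocks of the first order model of the projection are complementary. -/
theorem signBlock_model_mul_eq_zero (hH : H.IsHermitian) (G : Matrix (Fin n) (Fin n) ℝ) :
    (signBlock d 1 G + psdProj (signBlock d 0 H)) *
      (-signBlock d (-1) G + (psdProj (signBlock d 0 H) - signBlock d 0 H)) = 0 := by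
  have hG := signBlock_isHermitian (d := d) hH 0
  obtain ⟨hX, -, hXY⟩ := hG.psdProj_decomposition
  have hX1 : ∀ σ, σ ≠ 0 → psdProj (signBlock d 0 H) * signProj d σ = 0 := fun σ hσ =>
    hG.psdProj_mul_eq_zero <| by
      rw [signBlock, Matrix.mul_assoc, signProj_mul_signProj_of_ne d hσ.symm, Matrix.mul_zero]
  have hX2 : signProj d 1 * psdProj (signBlock d 0 H) = 0 := by
    have := congrArg Matrix.transpose (hX1 1 (by decide))
    rwa [Matrix.transpose_mul, signProj_transpose, Matrix.transpose_zero,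
      ← Matrix.conjTranspose_eq_transpose_of_trivial, hX.1.eq] at this
  have hG2 : signProj d 1 * signBlock d 0 H = 0 := by
    rw [signBlock, ← Matrix.mul_assoc, ← Matrix.mul_assoc,
      signProj_mul_signProj_of_ne d (by decide)]
    simp
  rw [Matrix.add_mul, Matrix.mul_add, Matrix.mul_add, hXY, add_zero]
  have a1 : signBlock d 1 G * -signBlock d (-1) G = 0 := by
    rw [Matrix.mul_neg, neg_eq_zero]
    calc _ = signProj d 1 * G * (signProj d 1 * signProj d (-1)) * G * signProj d (-1) := by
          simp only [signBlock, Matrix.mul_assoc]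
      _ = 0 := by rw [signProj_mul_signProj_of_ne d (by decide)]; simp
  have a2 : signBlock d 1 G * (psdProj (signBlock d 0 H) - signBlock d 0 H) = 0 := by
    rw [signBlock, Matrix.mul_assoc, Matrix.mul_sub, hX2, hG2]
    simp
  have a3 : psdProj (signBlock d 0 H) * -signBlock d (-1) G = 0 := by
    rw [Matrix.mul_neg, signBlock.eq_def d (-1), ← Matrix.mul_assoc, ← Matrix.mul_assoc,
      hX1 _ (by decide)]
    simp
  rw [a1, a2, a3]
  simp

theorem norm_commutator_le {m : Type*} [Fintype m] (A B : Matrix m m ℝ) :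
    ‖A * B - B * A‖ ≤ 2 * (‖A‖ * ‖B‖) := by
  refine (norm_sub_le _ _).trans ?_
  have h1 := Matrix.frobenius_norm_mul A B
  have h2 := Matrix.frobenius_norm_mul B A
  linarith

/-- The quadratic expansion of the projection at a diagonal matrix. -/
theorem norm_psdProj_diagonal_add_sub_le {c R : ℝ} (hc : 0 < c)
    (hd : ∀ i, d i = 0 ∨ c ≤ |d i|) (hR : ‖Matrix.diagonal d‖ ≤ R) (hH : H.IsHermitian)
    (hHc : ‖H‖ ≤ c / 2) :
    ‖psdProj (Matrix.diagonal d + H) - psdProj (Matrix.diagonal d) - diagonalDeriv d H‖ ≤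
      (6 * c⁻¹ + (3 + 4 * ‖(1 : Matrix (Fin n) (Fin n) ℝ)‖ +
        8 * ‖(1 : Matrix (Fin n) (Fin n) ℝ)‖ ^ 2) * (R + 2 * c) * c⁻¹ ^ 2) * ‖H‖ ^ 2 := by
  have hH0 := norm_nonneg H
  have hHc' : ‖H‖ ≤ c := by linarith
  have hci : 0 < c⁻¹ := inv_pos.2 hc
  have hG := signBlock_isHermitian (d := d) hH 0
  obtain ⟨hX, hY, hXY⟩ := hG.psdProj_decomposition
  have hΛ : (Matrix.diagonal d).IsHermitian := Matrix.isHermitian_diagonal d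
  have hP := (signBlock_one_posSemidef hd hH hHc').add hX
  have hQ := (signBlock_neg_one_posSemidef hd hH hHc').add hY
  have hPQ := signBlock_model_mul_eq_zero hH (d := d) (Matrix.diagonal d + H)
  have hKn := norm_signRotation_le (H := H) hc hd
  have hK2 : ‖signRotation d H‖ ≤ 1 / 2 := by
    -- The radius `c / 2` is what makes `‖K‖ ≤ 1 / 2`.
    refine hKn.trans ((mul_le_mul_of_nonneg_left hHc hci.le).trans_eq ?_)
    field_simp
  have key := norm_psdProj_sub_rotation_le (hΛ.add hH) (signRotation_transpose hH) hK2 hP hQ hPQ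
  have hcomm := signRotation_commutator d H
  have hdiag := signBlocks_diagonal d
  have hXn : ‖psdProj (signBlock d 0 H)‖ ≤ ‖H‖ :=
    hG.norm_psdProj_le.trans (norm_signBlock_le d H 0)
  have hYn : ‖psdProj (signBlock d 0 H) - signBlock d 0 H‖ ≤ ‖H‖ := by
    -- Changing the sign of a matrix swaps the two parts of its Moreau decomposition.
    have h1 : psdProj (-signBlock d 0 H) = psdProj (signBlock d 0 H) - signBlock d 0 H := by
      refine psdProj_eq_of_decomposition hY (by simpa using hX) ?_
      have := congrArg Matrix.conjTranspose hXY
      rw [Matrix.conjTranspose_mul, hX.1.eq, hY.1.eq, Matrix.conjTranspose_zero] at this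
      simpa using this
    rw [← h1]
    refine hG.neg.norm_psdProj_le.trans ?_
    rw [norm_neg]
    exact norm_signBlock_le d H 0
  have hNn : ∀ σ, ‖signBlock d σ (Matrix.diagonal d + H)‖ ≤ R + ‖H‖ := fun σ =>
    (norm_signBlock_le d _ σ).trans ((norm_add_le _ _).trans (by gcongr))
  have hPn : ‖signBlock d 1 (Matrix.diagonal d + H) + psdProj (signBlock d 0 H)‖ ≤ R + 2 * c := by
    refine (norm_add_le _ _).trans ?_
    linarith [hNn 1]
  have hQn : ‖-signBlock d (-1) (Matrix.diagonal d + H) +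
      (psdProj (signBlock d 0 H) - signBlock d 0 H)‖ ≤ R + 2 * c := by
    refine (norm_add_le _ _).trans ?_
    rw [norm_neg]
    linarith [hNn (-1)]
  have hBn := norm_signBlocks_le d H
  have hB1 := norm_signBlock_le d H 1
  rw [psdProj_diagonal hc.le hd, diagonalDeriv]
  simp only [signBlock_add] at key hPn hQn
  generalize signRotation d H = K at *
  generalize psdProj (signBlock d 0 H) = X at *
  generalize signBlock d 0 H = G at *
  generalize signBlock d 1 H = H₁ at *
  generalize signBlock d (-1) H = H₂ at *
  generalize signBlock d 1 (Matrix.diagonal d) = L₁ at *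
  generalize signBlock d (-1) (Matrix.diagonal d) = L₂ at *
  generalize psdProj (Matrix.diagonal d + H) = Z at *
  generalize Matrix.diagonal d = L at *
  subst hdiag
  have hs : 0 ≤ ‖(1 : Matrix (Fin n) (Fin n) ℝ)‖ := norm_nonneg _
  generalize ‖(1 : Matrix (Fin n) (Fin n) ℝ)‖ = s at *
  -- Here `P - Q` is `Λ` plus the diagonal blocks of `H`. Since `[K, Λ]` supplies the rest of `H`,
  -- only the second-order commutator of `K` with the blocks remains.
  have e1 : L₁ + L₂ + H - ((L₁ + H₁ + X - (-(L₂ + H₂) + (X - G))) +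
      (K * (L₁ + H₁ + X - (-(L₂ + H₂) + (X - G))) -
        (L₁ + H₁ + X - (-(L₂ + H₂) + (X - G))) * K)) =
      -(K * (H₁ + H₂ + G) - (H₁ + H₂ + G) * K) := by
    have e : L₁ + H₁ + X - (-(L₂ + H₂) + (X - G)) = (L₁ + L₂) + (H₁ + H₂ + G) := by abel
    rw [e, Matrix.mul_add K (L₁ + L₂), Matrix.add_mul (L₁ + L₂), eq_add_of_sub_eq hcomm]
    abel
  have e2 : Z - L₁ - (H₁ + X + (K * L₁ - L₁ * K)) =
      (Z - (L₁ + H₁ + X + (K * (L₁ + H₁ + X) - (L₁ + H₁ + X) * K))) +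
        (K * (H₁ + X) - (H₁ + X) * K) := by noncomm_ring
  rw [e1, norm_neg] at key
  have c1 := norm_commutator_le K (H₁ + H₂ + G)
  have c2 := norm_commutator_le K (H₁ + X)
  have hHX : ‖H₁ + X‖ ≤ 2 * ‖H‖ := (norm_add_le _ _).trans (by linarith)
  have d1 : ‖K‖ * ‖H₁ + H₂ + G‖ ≤ c⁻¹ * ‖H‖ * ‖H‖ := by gcongr
  have d2 : ‖K‖ * ‖H₁ + X‖ ≤ c⁻¹ * ‖H‖ * (2 * ‖H‖) := by gcongr
  have hC : 0 ≤ 1 + 4 * s + 8 * s ^ 2 := by positivity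
  have hm : 0 ≤ R + 2 * c := (norm_nonneg _).trans hPn
  have d3 : (2 * ‖L₁ + H₁ + X‖ + (1 + 4 * s + 8 * s ^ 2) * ‖-(L₂ + H₂) + (X - G)‖) * ‖K‖ ^ 2 ≤
      (2 * (R + 2 * c) + (1 + 4 * s + 8 * s ^ 2) * (R + 2 * c)) * (c⁻¹ * ‖H‖) ^ 2 := by gcongr
  rw [e2]
  calc _ ≤ _ := norm_add_le _ _
    -- The outer terms add up to `6 * c⁻¹`: `2` from the commutator in `e1` and `4` from the one in
    -- `e2`.
    _ ≤ 2 * (c⁻¹ * ‖H‖ * ‖H‖) +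
        (2 * (R + 2 * c) + (1 + 4 * s + 8 * s ^ 2) * (R + 2 * c)) * (c⁻¹ * ‖H‖) ^ 2 +
        2 * (c⁻¹ * ‖H‖ * (2 * ‖H‖)) := by linarith
    _ = _ := by ring

end SignBlocks

/-! ### Directional derivatives and the expansion at a symmetric matrix. -/

/-- A positively homogeneous map approximating the increments of `F` to second order consists of
directional derivatives. -/
theorem hasDirDerivAt_of_quadratic_bound {E G : Type*} [NormedAddCommGroup E] [NormedSpace ℝ E]
    [NormedAddCommGroup G] [NormedSpace ℝ G] {F : E → G} {A H : E} {D : E → G} {δ l : ℝ}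
    (hδ : 0 < δ) (hD : ∀ t : ℝ, 0 ≤ t → D (t • H) = t • D H)
    (h : ∀ t : ℝ, ‖t • H‖ ≤ δ → ‖F (A + t • H) - F A - D (t • H)‖ ≤ l * ‖t • H‖ ^ 2) :
    HasDirDerivAt F A H (D H) := by
  rw [HasDirDerivAt, tendsto_iff_norm_sub_tendsto_zero]
  have hlim : Tendsto (fun t : ℝ => l * ‖H‖ ^ 2 * t) (𝓝[>] 0) (𝓝 0) := by
    have : Tendsto (fun t : ℝ => l * ‖H‖ ^ 2 * t) (𝓝 0) (𝓝 (l * ‖H‖ ^ 2 * 0)) :=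
      (continuous_const.mul continuous_id).tendsto 0
    rw [mul_zero] at this
    exact this.mono_left nhdsWithin_le_nhds
  have hsmall : ∀ᶠ t : ℝ in 𝓝[>] 0, ‖t • H‖ ≤ δ := by
    have : Tendsto (fun t : ℝ => ‖t • H‖) (𝓝 0) (𝓝 ‖(0 : ℝ) • H‖) :=
      (continuous_id.smul continuous_const).norm.tendsto 0
    rw [zero_smul, norm_zero] at this
    exact ((this.eventually (ge_mem_nhds hδ))).filter_mono nhdsWithin_le_nhds
  refine squeeze_zero' (.of_forall fun t => norm_nonneg _) ?_ hlim
  filter_upwards [hsmall, self_mem_nhdsWithin] with t ht ht0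
  have ht0 : 0 < t := ht0
  have h1 := h t ht
  rw [hD t ht0.le, norm_smul, Real.norm_of_nonneg ht0.le] at h1
  have e : t⁻¹ • (F (A + t • H) - F A) - D H = t⁻¹ • (F (A + t • H) - F A - t • D H) := by
    rw [smul_sub t⁻¹ _ (t • D H), inv_smul_smul₀ ht0.ne']
  rw [e, norm_smul, norm_inv, Real.norm_of_nonneg ht0.le, inv_mul_le_iff₀ ht0]
  linarith

/-- The expansion of the projection, uniform over symmetric matrices whose norm is bounded by `R`
and whose nonzero eigenvalues are bounded away from zero by `c`. -/
theorem Matrix.IsHermitian.exists_psdProj_expansion {n : ℕ} {A : Matrix (Fin n) (Fin n) ℝ}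
    (hA : A.IsHermitian) {c R : ℝ} (hc : 0 < c) (hR : ‖A‖ ≤ R)
    (hd : ∀ i, hA.eigenvalues i = 0 ∨ c ≤ |hA.eigenvalues i|) :
    ∃ D : Matrix (Fin n) (Fin n) ℝ → Matrix (Fin n) (Fin n) ℝ,
      (∀ H : Matrix (Fin n) (Fin n) ℝ, H.IsHermitian → ∀ t : ℝ, 0 ≤ t → D (t • H) = t • D H) ∧
      ∀ H : Matrix (Fin n) (Fin n) ℝ, H.IsHermitian → ‖H‖ ≤ c / 2 →
        ‖psdProj (A + H) - psdProj A - D H‖ ≤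
          (6 * c⁻¹ + (3 + 4 * ‖(1 : Matrix (Fin n) (Fin n) ℝ)‖ +
            8 * ‖(1 : Matrix (Fin n) (Fin n) ℝ)‖ ^ 2) * (R + 2 * c) * c⁻¹ ^ 2) * ‖H‖ ^ 2 := by
  obtain ⟨U, hU, hU', hAU⟩ := hA.exists_eq_mul_diagonal_mul_transpose
  generalize hA.eigenvalues = d at hd hAU
  have hconj : ∀ H : Matrix (Fin n) (Fin n) ℝ, H.IsHermitian →
      (U.transpose * H * U).IsHermitian := fun H hH =>
    Matrix.isHermitian_conjTranspose_mul_mul U hH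
  have hback : ∀ H : Matrix (Fin n) (Fin n) ℝ,
      U * (U.transpose * H * U) * U.transpose = H := fun H => by
    calc _ = (U * U.transpose) * H * (U * U.transpose) := by simp only [Matrix.mul_assoc]
      _ = H := by rw [hU', Matrix.one_mul, Matrix.mul_one]
  have hnorm : ∀ H : Matrix (Fin n) (Fin n) ℝ, ‖U.transpose * H * U‖ = ‖H‖ := fun H => by
    rw [← Matrix.frobenius_norm_conj hU, hback]
  -- The projection commutes with orthogonal conjugation, which preserves the norm, so the diagonal
  -- case carries over with the same constants.
  refine ⟨fun H => U * diagonalDeriv d (U.transpose * H * U) * U.transpose,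
    fun H hH t ht => ?_, fun H hH hHc => ?_⟩
  · dsimp only
    rw [Matrix.mul_smul, Matrix.smul_mul, diagonalDeriv_smul (hconj H hH) ht, Matrix.mul_smul,
      Matrix.smul_mul]
  · have hΛ : (Matrix.diagonal d).IsHermitian := Matrix.isHermitian_diagonal d
    have hRd : ‖Matrix.diagonal d‖ ≤ R := by rwa [← Matrix.frobenius_norm_conj hU, ← hAU]
    have key := norm_psdProj_diagonal_add_sub_le hc hd hRd (hconj H hH) (by rwa [hnorm])
    rw [hnorm] at key
    have e : A + H = U * (Matrix.diagonal d + U.transpose * H * U) * U.transpose := by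
      rw [Matrix.mul_add, Matrix.add_mul, hback, ← hAU]
    rw [e, (hΛ.add (hconj H hH)).psdProj_conj hU, hAU, hΛ.psdProj_conj hU, ← Matrix.sub_mul,
      ← Matrix.mul_sub, ← Matrix.sub_mul, ← Matrix.mul_sub, Matrix.frobenius_norm_conj hU]
    exact key

/-! ### Weyl's inequality. -/

theorem Matrix.IsHermitian.dotProduct_mulVec_eq_sum {ι : Type*} [Fintype ι] [DecidableEq ι]
    {A : Matrix ι ι ℝ} (hA : A.IsHermitian) (x : EuclideanSpace ℝ ι) :
    x.ofLp ⬝ᵥ A.mulVec x.ofLp =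
      ∑ i, hA.eigenvalues i * inner ℝ (hA.eigenvectorBasis i) x ^ 2 := by
  have h1 : x.ofLp ⬝ᵥ A.mulVec x.ofLp = inner ℝ x (WithLp.toLp 2 (A.mulVec x.ofLp)) := by
    rw [EuclideanSpace.inner_eq_star_dotProduct, star_trivial, dotProduct_comm]
  rw [h1, ← hA.eigenvectorBasis.sum_inner_mul_inner]
  refine Finset.sum_congr rfl fun i _ => ?_
  have h2 : inner ℝ (hA.eigenvectorBasis i) (WithLp.toLp 2 (A.mulVec x.ofLp)) =
      hA.eigenvalues i * inner ℝ (hA.eigenvectorBasis i) x := by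
    rw [EuclideanSpace.inner_eq_star_dotProduct, EuclideanSpace.inner_eq_star_dotProduct,
      star_trivial, dotProduct_comm, Matrix.dotProduct_mulVec, ← Matrix.mulVec_transpose,
      ← Matrix.conjTranspose_eq_transpose_of_trivial, hA.eq, hA.mulVec_eigenvectorBasis,
      smul_dotProduct, smul_eq_mul, dotProduct_comm]
  rw [h2, real_inner_comm x]
  ring

/-- **Weyl's inequality** for the ordered eigenvalues, in the Frobenius norm. -/
theorem Matrix.IsHermitian.eigenvalues₀_sub_le {ι : Type*} [Fintype ι] [DecidableEq ι]
    {A B : Matrix ι ι ℝ} (hA : A.IsHermitian) (hB : B.IsHermitian)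
    (i : Fin (Fintype.card ι)) : hA.eigenvalues₀ i - hB.eigenvalues₀ i ≤ ‖A - B‖ := by
  -- The enumeration by which `eigenvalues` is defined from `eigenvalues₀`; hence the `rfl` proofs
  -- below.
  set e : Fin (Fintype.card ι) ≃ ι := Fintype.equivOfCardEq (Fintype.card_fin _) with he
  have heA : ∀ j, hA.eigenvalues j = hA.eigenvalues₀ (e.symm j) := fun j => rfl
  have heB : ∀ j, hB.eigenvalues j = hB.eigenvalues₀ (e.symm j) := fun j => rfl
  -- A vector orthogonal to the eigenvectors of `A` after `i` and to those of `B` before `i` obeys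
  -- one condition fewer than the dimension, so a nonzero one exists. Its quadratic form is at least
  -- `λ_i(A) ‖x‖²` for `A` and at most `λ_i(B) ‖x‖²` for `B`.
  let f : EuclideanSpace ℝ ι →ₗ[ℝ] ({j : Fin (Fintype.card ι) // j ≠ i} → ℝ) :=
    LinearMap.pi fun j => if i < j.1 then (innerSL ℝ (hA.eigenvectorBasis (e j.1))).toLinearMap
      else (innerSL ℝ (hB.eigenvectorBasis (e j.1))).toLinearMap
  have hker : LinearMap.ker f ≠ ⊥ := by
    refine LinearMap.ker_ne_bot_of_finrank_lt ?_
    have : 0 < Fintype.card ι := i.pos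
    simp
    omega
  obtain ⟨x, hx, hx0⟩ := (Submodule.ne_bot_iff _).1 hker
  have hx1 : ∀ j, i < j → inner ℝ (hA.eigenvectorBasis (e j)) x = 0 := fun j hj => by
    simpa [f, hj] using congrFun hx ⟨j, hj.ne'⟩
  have hx2 : ∀ j, j < i → inner ℝ (hB.eigenvectorBasis (e j)) x = 0 := fun j hj => by
    simpa [f, hj.not_gt] using congrFun hx ⟨j, hj.ne⟩
  have hxx : x.ofLp ⬝ᵥ x.ofLp = ‖x‖ ^ 2 := by
    rw [← real_inner_self_eq_norm_sq, EuclideanSpace.inner_eq_star_dotProduct, star_trivial]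
  have hpos : 0 < ‖x‖ ^ 2 := by
    have := norm_pos_iff.2 hx0
    positivity
  have hA1 : hA.eigenvalues₀ i * ‖x‖ ^ 2 ≤ x.ofLp ⬝ᵥ A.mulVec x.ofLp := by
    rw [hA.dotProduct_mulVec_eq_sum, ← hA.eigenvectorBasis.sum_sq_inner_right x, Finset.mul_sum]
    refine Finset.sum_le_sum fun j _ => ?_
    rcases lt_or_ge i (e.symm j) with h | h
    · have := hx1 _ h
      rw [Equiv.apply_symm_apply] at this
      simp [this]
    · rw [heA]
      exact mul_le_mul_of_nonneg_right (hA.eigenvalues₀_antitone h) (sq_nonneg _)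
  have hB1 : x.ofLp ⬝ᵥ B.mulVec x.ofLp ≤ hB.eigenvalues₀ i * ‖x‖ ^ 2 := by
    rw [hB.dotProduct_mulVec_eq_sum, ← hB.eigenvectorBasis.sum_sq_inner_right x, Finset.mul_sum]
    refine Finset.sum_le_sum fun j _ => ?_
    rcases lt_or_ge (e.symm j) i with h | h
    · have := hx2 _ h
      rw [Equiv.apply_symm_apply] at this
      simp [this]
    · rw [heB]
      exact mul_le_mul_of_nonneg_right (hB.eigenvalues₀_antitone h) (sq_nonneg _)
  have hAB := (le_abs_self _).trans (Matrix.abs_dotProduct_mulVec_le (A - B) x.ofLp)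
  rw [Matrix.sub_mulVec, dotProduct_sub, hxx] at hAB
  refine le_of_mul_le_mul_right ?_ hpos
  linarith

theorem Matrix.IsHermitian.abs_eigenvalues₀_sub_le {ι : Type*} [Fintype ι] [DecidableEq ι]
    {A B : Matrix ι ι ℝ} (hA : A.IsHermitian) (hB : B.IsHermitian)
    (i : Fin (Fintype.card ι)) : |hA.eigenvalues₀ i - hB.eigenvalues₀ i| ≤ ‖A - B‖ := by
  rw [abs_le]
  have h := hB.eigenvalues₀_sub_le hA i
  rw [norm_sub_rev] at h
  exact ⟨by linarith, hA.eigenvalues₀_sub_le hB i⟩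

/-! ### Uniform constants near the base matrix. -/

theorem mainTheorem7 (n : ℕ) (Abar : Matrix (Fin n) (Fin n) ℝ) (hAbar : Abar.IsHermitian)
    (r : ℝ) (hr : 0 < r)
    (hgap : ∀ i j, hAbar.eigenvalues₀ j < hAbar.eigenvalues₀ i →
      r < (hAbar.eigenvalues₀ i - hAbar.eigenvalues₀ j) / 3)
    (hzero : ∀ i, hAbar.eigenvalues₀ i ≠ 0 → r < |hAbar.eigenvalues₀ i|) :
    ∃ δ > 0, ∃ l > 0, ∀ (A : Matrix (Fin n) (Fin n) ℝ) (hA : A.IsHermitian),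
      ‖A - Abar‖ ≤ r → SameEigenIndexPartition hA hAbar →
      ∃ D : Matrix (Fin n) (Fin n) ℝ → Matrix (Fin n) (Fin n) ℝ,
        (∀ H : Matrix (Fin n) (Fin n) ℝ, H.IsHermitian → HasDirDerivAt psdProj A H (D H)) ∧
        ∀ H : Matrix (Fin n) (Fin n) ℝ, H.IsHermitian → ‖H‖ ≤ δ →
          ‖psdProj (A + H) - psdProj A - D H‖ ≤ l * ‖H‖ ^ 2 := by
  -- Finitely many strict inequalities in `hzero` leave a common slack `c`. Arguing with small `c`
  -- covers the case of no nonzero eigenvalue.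
  obtain ⟨c, hc, hcb⟩ : ∃ c > 0, ∀ i, hAbar.eigenvalues₀ i ≠ 0 →
      r + c ≤ |hAbar.eigenvalues₀ i| := by
    have h : ∀ i, ∀ᶠ c : ℝ in 𝓝[>] 0, hAbar.eigenvalues₀ i ≠ 0 →
        r + c ≤ |hAbar.eigenvalues₀ i| := fun i => by
      by_cases hi : hAbar.eigenvalues₀ i = 0
      · simp [hi]
      · have := sub_pos.2 (hzero i hi)
        filter_upwards [Ioo_mem_nhdsGT this] with c hc _
        linarith [hc.2]
    obtain ⟨c, hc, hc0⟩ := ((eventually_all.2 h).and self_mem_nhdsWithin).exists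
    exact ⟨c, hc0, hc⟩
  refine ⟨c / 2, by positivity, 6 * c⁻¹ + (3 + 4 * ‖(1 : Matrix (Fin n) (Fin n) ℝ)‖ +
    8 * ‖(1 : Matrix (Fin n) (Fin n) ℝ)‖ ^ 2) * (‖Abar‖ + r + 2 * c) * c⁻¹ ^ 2, by positivity,
    fun A hA hAr hpart => ?_⟩
  have hR : ‖A‖ ≤ ‖Abar‖ + r := by
    have := norm_le_insert' A Abar
    linarith
  have hd : ∀ i, hA.eigenvalues₀ i = 0 ∨ c ≤ |hA.eigenvalues₀ i| := fun i => by
    rw [or_iff_not_imp_left]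
    intro hi
    -- The marked zero set is what matters: `λ_i(A) ≠ 0` forces `λ_i(Abar) ≠ 0`, and Weyl's
    -- inequality costs at most `r` of the margin `r + c`.
    have h1 := hcb i fun h => hi ((hpart.2 i).2 h)
    have h2 := (hAbar.abs_eigenvalues₀_sub_le hA i).trans
      ((norm_sub_rev _ _).le.trans hAr)
    have h3 := abs_sub_abs_le_abs_sub (hAbar.eigenvalues₀ i) (hA.eigenvalues₀ i)
    linarith
  obtain ⟨D, hD, hDb⟩ := hA.exists_psdProj_expansion hc hR fun i => hd _
  refine ⟨D, fun H hH => ?_, hDb⟩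
  refine hasDirDerivAt_of_quadratic_bound (half_pos hc) (hD H hH) fun t ht => hDb _ ?_ ht
  rw [Matrix.IsHermitian, Matrix.conjTranspose_smul, hH.eq, star_trivial]
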